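/- **Theorem 2.5.** Let $n\ge 1$, let $\mathbb F_n^+$ be the unital free semigroup on generators $g_1,\dots,g_n$ with neutral element $g_0$, and let $|\alpha|$ denote the length of the word $\alpha\in\mathbb F_n^+$. For bounded operators $T_1,\dots,T_n$ on a Hilbert space put $T_\alpha:=T_{i_1}\cdots T_{i_k}$ if $\alpha=g_{i_1}\cdots g_{i_k}$, and $T_{g_0}:=I$. All Hilbert spaces are complex, and $\otimes$ is the Hilbert space tensor product. Let $\mathcal H$ be a Hilbert space and let $A_{(\alpha)}\in B(\mathcal H)$, $\alpha\in\mathbb F_n^+$, with $A_{(0)}:=A_{(g_0)}$, be such that $$F(X_1,\dots,X_n)=\sum_{k=0}^\infty\sum_{|\alpha|=k}X_\alpha\otimes A_{(\alpha)}$$ is a holomorphic function on the open unit ball $[B(\mathcal X)^n]_{<1}:=\{(X_1,\dots,X_n)\in B(\mathcal X)^n:\ \|X_1X_1^*+\cdots+X_nX_n^*\|<1\}$, that is, the series in $k$ converges in the operator norm for every Hilbert space $\mathcal X$ and every $(X_1,\dots,X_n)\in[B(\mathcal X)^n]_{<1}$. Suppose that $F(0)\ge 0$ and that $\operatorname{Re}F(X_1,\dots,X_n)\le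 I$ for every Hilbert space $\mathcal X$ and every $(X_1,\dots,X_n)\in[B(\mathcal X)^n]_{<1}$. Let $S_1,\dots,S_n$ be the left creation operators $S_i\varphi=e_i\otimes\varphi$ on the full Fock space $F^2(H_n)=\bigoplus_{k\ge0}H_n^{\otimes k}$, where $H_n$ is an $n$-dimensional Hilbert space with orthonormal basis $e_1,\dots,e_n$. Then: 1. If $\mathcal K$ is a Hilbert space and $Y_1,\dots,Y_n\in B(\mathcal K)$ satisfy $\|[Y_1^*,\dots,Y_n^*]\|\le\frac13$ (the norm of the row operator $\mathcal K^n\to\mathcal K$), then the series defining $F(S_1\otimes Y_1,\dots,S_n\otimes Y_n)$ converges in the operator norm and $\|F(S_1\otimes Y_1,\dots,S_n\otimes Y_n)\|\le1$. 2. $\sum_{|\alpha|=k}A_{(\alpha)}^*A_{(\alpha)}\le4(I-A_{(0)})$ for every $k\ge1$. 3. $\bigl\|\sum_{|\alpha|=k}A_{(\alpha)}^*A_{(\alpha)}\bigr\|^{1/2}\le2\|I-A_{(0)}\|$ for every $k\ge1$. 4. For $0\le r<1$, $$\sum_{k=0}^\infty r^k\Bigl(\sum_{|\alpha|=k}A_{(\alpha)}^*A_{(\alpha)}\Bigr)^{1/2}\le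 M(r)I,\qquad M(r):=\begin{cases}1+\dfrac{r^2}{(1-r)^2}&\text{if }0\le r\le\frac12,\\[1ex]\dfrac{2r}{1-r}&\text{if }\frac12<r<1,\end{cases}$$ where the series converges in the operator norm. 5. If $\|A_{(0)}\|<1$, then $I-A_{(0)}$ is invertible, and for $0\le r<1$ $$A_{(0)}+\sum_{k=1}^\infty\sum_{|\alpha|=k}r^kA_{(\alpha)}^*(I-A_{(0)})^{-1}A_{(\alpha)}\le K(r)I,\qquad K(r):=\begin{cases}1&\text{if }0\le r\le\frac15,\\[1ex]\dfrac{4r}{1-r}&\text{if }\frac15<r<1,\end{cases}$$ where the series in $k$ converges in the operator norm. 6. For $0\le r\le\frac13$, $\displaystyle\sum_{k=0}^\infty r^k\Bigl\|\sum_{|\alpha|=k}A_{(\alpha)}^*A_{(\alpha)}\Bigr\|^{1/2}\le\|A_{(0)}\|+\|I-A_{(0)}\|$. -/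

import Mathlib

open scoped TensorProduct Topology

universe v w u

namespace NCBohr

noncomputable section

/-- Words of length `k` in the unital free semigroup on `n` generators. -/
def words (n k : ℕ) : Finset (FreeMonoid (Fin n)) :=
  Finset.univ.map ⟨fun w : Fin k → Fin n => FreeMonoid.ofList (List.ofFn w),
    FreeMonoid.ofList.injective.comp List.ofFn_injective⟩

theorem mem_words {n k : ℕ} {α : FreeMonoid (Fin n)} : α ∈ words n k ↔ α.length = k := by
  simp only [words, Finset.mem_map, Finset.mem_univ, true_and,
    Function.Embedding.coeFn_mk]
  constructor
  · rintro ⟨w, rfl⟩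
    simp [FreeMonoid.length]
  · rintro rfl
    exact ⟨fun i => α.toList.get i, by
      apply FreeMonoid.toList.injective
      simp only [FreeMonoid.toList_ofList]
      exact List.ofFn_get _⟩

/-- The bounded operators on a complex inner product space. -/
abbrev BOp (E : Type*) [NormedAddCommGroup E] [InnerProductSpace ℂ E] := E →L[ℂ] E

/-- The Hilbert space tensor product: the completion of the algebraic tensor product for the
inner product determined by `⟪x ⊗ y, x' ⊗ y'⟫ = ⟪x, x'⟫ * ⟪y, y'⟫`. -/
abbrev HilbertTensor (E F : Type*) [NormedAddCommGroup E] [InnerProductSpace ℂ E]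
    [NormedAddCommGroup F] [InnerProductSpace ℂ F] :=
  UniformSpace.Completion (E ⊗[ℂ] F)

/-- The bounded operator `S ⊗ T` on the Hilbert space tensor product. -/
def opTensor {E F : Type*} [NormedAddCommGroup E] [InnerProductSpace ℂ E]
    [NormedAddCommGroup F] [InnerProductSpace ℂ F] (S : BOp E) (T : BOp F) :
    BOp (HilbertTensor E F) :=
  (TensorProduct.mapL S T).completion

theorem opTensor_tmul {E F : Type*} [NormedAddCommGroup E] [InnerProductSpace ℂ E]
    [NormedAddCommGroup F] [InnerProductSpace ℂ F] (S : BOp E) (T : BOp F) (x : E) (y : F) :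
    opTensor S T ((x ⊗ₜ[ℂ] y : E ⊗[ℂ] F) : HilbertTensor E F)
      = ((S x ⊗ₜ[ℂ] T y : E ⊗[ℂ] F) : HilbertTensor E F) :=
  UniformSpace.Completion.map_coe (TensorProduct.mapL S T).uniformContinuous _

/-- `T_α = T_{i₁} ⋯ T_{i_k}` for `α = g_{i₁} ⋯ g_{i_k}`, and `T_α = I` for the empty word. -/
def evalWord {n : ℕ} {E : Type*} [NormedAddCommGroup E] [InnerProductSpace ℂ E]
    (T : Fin n → BOp E) (α : FreeMonoid (Fin n)) : BOp E :=
  FreeMonoid.lift T α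

/-- The full Fock space of an `n`-dimensional Hilbert space with orthonormal basis
`e_1, …, e_n`, in the coordinates of its orthonormal basis
`e_α = e_{i₁} ⊗ ⋯ ⊗ e_{i_k}` indexed by the words `α = g_{i₁} ⋯ g_{i_k}`. -/
abbrev FockSpace (n : ℕ) := lp (fun _ : FreeMonoid (Fin n) => ℂ) 2

theorem of_mul_injective {n : ℕ} (i : Fin n) :
    Function.Injective fun β : FreeMonoid (Fin n) => FreeMonoid.of i * β :=
  fun _ _ h => mul_left_cancel h

/-- The coordinates of `e_i ⊗ φ`: the value at `g_i β` is `φ(β)`, and the value at a word that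
does not begin with the letter `g_i` is `0`. -/
def creationFun {n : ℕ} (i : Fin n) (φ : FreeMonoid (Fin n) → ℂ) : FreeMonoid (Fin n) → ℂ :=
  Function.extend (fun β : FreeMonoid (Fin n) => FreeMonoid.of i * β) φ 0

theorem creationFun_of_mul {n : ℕ} (i : Fin n) (φ : FreeMonoid (Fin n) → ℂ)
    (β : FreeMonoid (Fin n)) : creationFun i φ (FreeMonoid.of i * β) = φ β :=
  (of_mul_injective i).extend_apply _ _ _

theorem creationFun_of_ne {n : ℕ} (i : Fin n) (φ : FreeMonoid (Fin n) → ℂ)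
    (α : FreeMonoid (Fin n)) (h : ¬ ∃ β, FreeMonoid.of i * β = α) : creationFun i φ α = 0 :=
  Function.extend_apply' _ _ _ h

theorem creationFun_sq {n : ℕ} (i : Fin n) (φ : FreeMonoid (Fin n) → ℂ) :
    (fun α => ‖creationFun i φ α‖ ^ 2)
      = Function.extend (fun β : FreeMonoid (Fin n) => FreeMonoid.of i * β)
          (fun β => ‖φ β‖ ^ 2) 0 := by
  funext α
  by_cases h : ∃ β, FreeMonoid.of i * β = α
  · obtain ⟨β, rfl⟩ := h
    rw [creationFun_of_mul, (of_mul_injective i).extend_apply]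
  · rw [creationFun_of_ne i φ α h, Function.extend_apply' _ _ _ h]
    simp

theorem creationFun_memℓp {n : ℕ} (i : Fin n) (φ : FockSpace n) :
    Memℓp (E := fun _ : FreeMonoid (Fin n) => ℂ) (creationFun i φ) 2 := by
  refine memℓp_gen ?_
  have h := (memℓp_gen_iff (by norm_num)).1 (lp.memℓp φ)
  simp only [ENNReal.toReal_ofNat, Real.rpow_ofNat] at h ⊢
  rw [creationFun_sq]
  refine (Function.Injective.summable_iff (of_mul_injective i) (fun α hα => ?_)).1 ?_
  · rw [Function.extend_apply' _ _ _ (by simpa using hα)]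
    rfl
  · simpa [Function.comp_def, (of_mul_injective i).extend_apply] using h

/-- The left creation operator `S_i φ = e_i ⊗ φ`. -/
def creation {n : ℕ} (i : Fin n) : BOp (FockSpace n) :=
  LinearIsometry.toContinuousLinearMap
    { toFun := fun φ => ⟨creationFun i φ, creationFun_memℓp i φ⟩
      map_add' := by
        intro φ ψ
        refine lp.ext (funext fun α => ?_)
        change creationFun i ((φ : FreeMonoid (Fin n) → ℂ) + ψ) α
          = creationFun i φ α + creationFun i ψ α
        by_cases h : ∃ β, FreeMonoid.of i * β = α
        · obtain ⟨β, rfl⟩ := h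
          simp only [creationFun_of_mul, Pi.add_apply]
        · simp [creationFun_of_ne i _ α h]
      map_smul' := by
        intro c φ
        refine lp.ext (funext fun α => ?_)
        change creationFun i (c • (φ : FreeMonoid (Fin n) → ℂ)) α = c • creationFun i φ α
        by_cases h : ∃ β, FreeMonoid.of i * β = α
        · obtain ⟨β, rfl⟩ := h
          simp only [creationFun_of_mul, Pi.smul_apply]
        · simp [creationFun_of_ne i _ α h]
      norm_map' := by
        intro φ
        rw [lp.norm_eq_tsum_rpow (by norm_num), lp.norm_eq_tsum_rpow (by norm_num)]
        simp only [ENNReal.toReal_ofNat, Real.rpow_ofNat]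
        congr 1
        change ∑' α, ‖creationFun i φ α‖ ^ 2 = _
        rw [creationFun_sq]
        exact tsum_extend_zero (of_mul_injective i) _ }

theorem creation_apply {n : ℕ} (i : Fin n) (φ : FockSpace n) (α : FreeMonoid (Fin n)) :
    creation i φ α = creationFun i φ α :=
  rfl

/-- The homogeneous part `∑_{|α| = k} X_α ⊗ A_α`. -/
def homPart {n : ℕ} {H E : Type*} [NormedAddCommGroup H] [InnerProductSpace ℂ H]
    [NormedAddCommGroup E] [InnerProductSpace ℂ E] (A : FreeMonoid (Fin n) → BOp H)
    (X : Fin n → BOp E) (k : ℕ) : BOp (HilbertTensor E H) :=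
  ∑ α ∈ words n k, opTensor (evalWord X α) (A α)

/-- The series `F(X) = ∑_k ∑_{|α| = k} X_α ⊗ A_α` converges in the operator norm, with sum `L`. -/
def HasValue {n : ℕ} {H E : Type*} [NormedAddCommGroup H] [InnerProductSpace ℂ H]
    [NormedAddCommGroup E] [InnerProductSpace ℂ E] (A : FreeMonoid (Fin n) → BOp H)
    (X : Fin n → BOp E) (L : BOp (HilbertTensor E H)) : Prop :=
  Filter.Tendsto (fun N => ∑ k ∈ Finset.range N, homPart A X k) Filter.atTop (𝓝 L)

/-- The open unit ball `[B(E)^n]_{<1}`. -/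
def opBall (n : ℕ) (E : Type*) [NormedAddCommGroup E] [InnerProductSpace ℂ E]
    [CompleteSpace E] : Set (Fin n → BOp E) :=
  {X | ‖∑ i, X i * star (X i)‖ < 1}

/-- The row operator `[T_1, …, T_n] : E ⊕ ⋯ ⊕ E → E`. -/
def rowOp {n : ℕ} {E : Type*} [NormedAddCommGroup E] [InnerProductSpace ℂ E]
    (T : Fin n → BOp E) : PiLp 2 (fun _ : Fin n => E) →L[ℂ] E :=
  ∑ i, T i ∘L PiLp.proj 2 (fun _ : Fin n => E) i

/-- The coefficients `A` generate a holomorphic function on the open unit ball: the series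
converges in norm at every point of `[B(E)^n]_{<1}`, for every Hilbert space `E`
(of an arbitrary universe `v`). -/
def IsHolomorphicOnBall {n : ℕ} {H : Type u} [NormedAddCommGroup H]
    [InnerProductSpace ℂ H] (A : FreeMonoid (Fin n) → BOp H) : Prop :=
  ∀ (E : Type v) [NormedAddCommGroup E] [InnerProductSpace ℂ E] [CompleteSpace E]
    (X : Fin n → BOp E), X ∈ opBall n E → ∃ L, HasValue A X L

/-- `F(0) ≥ 0`, for every underlying Hilbert space. -/
def NonnegAtZero {n : ℕ} {H : Type u} [NormedAddCommGroup H]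
    [InnerProductSpace ℂ H] (A : FreeMonoid (Fin n) → BOp H) : Prop :=
  ∀ (E : Type v) [NormedAddCommGroup E] [InnerProductSpace ℂ E] [CompleteSpace E]
    (L : BOp (HilbertTensor E H)), HasValue A (0 : Fin n → BOp E) L → 0 ≤ L

/-- `Re F(X) ≤ I` for every `X` in the open unit ball, for every underlying Hilbert space. -/
def ReLeOneOnBall {n : ℕ} {H : Type u} [NormedAddCommGroup H]
    [InnerProductSpace ℂ H] (A : FreeMonoid (Fin n) → BOp H) : Prop :=
  ∀ (E : Type v) [NormedAddCommGroup E] [InnerProductSpace ℂ E] [CompleteSpace E]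
    (X : Fin n → BOp E), X ∈ opBall n E →
      ∀ L : BOp (HilbertTensor E H), HasValue A X L → (realPart L : BOp (HilbertTensor E H)) ≤ 1

/-- The sum `∑_{|α| = k} A_α^* A_α`. -/
def coeffSq {n : ℕ} {H : Type*} [NormedAddCommGroup H] [InnerProductSpace ℂ H]
    [CompleteSpace H] (A : FreeMonoid (Fin n) → BOp H) (k : ℕ) : BOp H :=
  ∑ α ∈ words n k, star (A α) * A α

/-- The constant `M(r)`, for `0 ≤ r < 1`. -/
def M (r : ℝ) : ℝ := if r ≤ 1 / 2 then 1 + r ^ 2 / (1 - r) ^ 2 else 2 * r / (1 - r)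

/-- The constant `K(r)`, for `0 ≤ r < 1`. -/
def K (r : ℝ) : ℝ := if r ≤ 1 / 5 then 1 else 4 * r / (1 - r)

end

end NCBohr

/-
Evaluate `Re F ≤ I` at `rS`, where `S` is the tuple of creation operators, on vectors supported on
the words of length `0` and `k`. Letting `r → 1` shows that the operator matrix with diagonal
entries `2(I - A₀)` and first column `A_α`, `|α| = k`, is positive. Testing its quadratic form
against `(x, t T A_α x)` and optimizing over `t` bounds `∑ A_α^* T A_α`; the choices `T = I` and
`T = (I - A₀)⁻¹` give the coefficient estimates, and summing over `k` reduces the remaining bounds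
to inequalities between polynomials in `(I - A₀)^{1/2}`. For the contractivity at radius `1/3`, the
`2 × 2` blocks with diagonal `2(I - A₀)` and corner `A_α` stay positive under tensoring with `I`,
conjugation and sums, so the homogeneous part of degree `k` is dominated by `2 · 3⁻ᵏ (I - A₀)`.
These weights sum to `I - A₀`, and adding the degree-zero term `A₀` leaves a positive block with
diagonal `I` and corner `F(S ⊗ Y)`.
-/

namespace NCBohr

noncomputable section

section QuadraticForm

variable {H : Type*} [NormedAddCommGroup H] [InnerProductSpace ℂ H]

theorem re_inner_nonneg {P : BOp H} (hP : 0 ≤ P) (x : H) : 0 ≤ (inner ℂ x (P x)).re :=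
  ((ContinuousLinearMap.nonneg_iff_isPositive P).1 hP).re_inner_nonneg_right x

theorem re_inner_mono {P Q : BOp H} (h : P ≤ Q) (x : H) :
    (inner ℂ x (P x)).re ≤ (inner ℂ x (Q x)).re := by
  have := ((ContinuousLinearMap.le_def P Q).1 h).re_inner_nonneg_right x
  rwa [sub_apply, inner_sub_right, map_sub, sub_nonneg] at this

theorem re_inner_le_norm_mul_sq (P : BOp H) (x : H) :
    (inner ℂ x (P x)).re ≤ ‖P‖ * ‖x‖ ^ 2 :=
  calc (inner ℂ x (P x)).re ≤ ‖x‖ * ‖P x‖ := re_inner_le_norm (𝕜 := ℂ) x (P x)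
    _ ≤ ‖x‖ * (‖P‖ * ‖x‖) := by gcongr; exact P.le_opNorm x
    _ = ‖P‖ * ‖x‖ ^ 2 := by ring

theorem re_inner_smul_apply (c : ℝ) (P : BOp H) (x y : H) :
    (inner ℂ x ((c • P) y)).re = c * (inner ℂ x (P y)).re := by
  rw [smul_apply, inner_smul_right_eq_smul, Complex.smul_re, smul_eq_mul]

theorem inner_sum_apply {ι : Type*} (s : Finset ι) (P : ι → BOp H) (x y : H) :
    inner ℂ x ((∑ i ∈ s, P i) y) = ∑ i ∈ s, inner ℂ x (P i y) := by
  rw [sum_apply, inner_sum]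

variable [CompleteSpace H]

theorem le_of_re_inner_le {P Q : BOp H} (hP : IsSelfAdjoint P) (hQ : IsSelfAdjoint Q)
    (h : ∀ x, (inner ℂ x (P x)).re ≤ (inner ℂ x (Q x)).re) : P ≤ Q := by
  rw [ContinuousLinearMap.le_def, ContinuousLinearMap.isPositive_def']
  refine ⟨hQ.sub hP, fun x => ?_⟩
  rw [ContinuousLinearMap.reApplyInnerSelf_apply, inner_re_symm, sub_apply, inner_sub_right,
    map_sub]
  exact sub_nonneg.2 (h x)

theorem inner_star_apply (P : BOp H) (x y : H) : inner ℂ x (star P y) = inner ℂ (P x) y := by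
  rw [ContinuousLinearMap.star_eq_adjoint, ContinuousLinearMap.adjoint_inner_right]

theorem re_inner_realPart_apply (L : BOp H) (x : H) :
    (inner ℂ x ((realPart L : BOp H) x)).re = (inner ℂ x (L x)).re := by
  rw [realPart_apply_coe, re_inner_smul_apply, add_apply, inner_add_right, Complex.add_re,
    inner_star_apply, ← inner_conj_symm (L x) x, Complex.conj_re]
  ring

end QuadraticForm

section OpTensor

variable {E F : Type*} [NormedAddCommGroup E] [InnerProductSpace ℂ E]
  [NormedAddCommGroup F] [InnerProductSpace ℂ F]

/-- The elementary tensor `x ⊗ y`, as a vector of the Hilbert space tensor product. -/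
def pureTensor (x : E) (y : F) : HilbertTensor E F :=
  ((x ⊗ₜ[ℂ] y : E ⊗[ℂ] F) : HilbertTensor E F)

theorem pureTensor_add (x : E) (y y' : F) :
    pureTensor x (y + y') = pureTensor x y + pureTensor x y' := by
  simp only [pureTensor, TensorProduct.tmul_add, UniformSpace.Completion.coe_add]

theorem inner_pureTensor (x x' : E) (y y' : F) :
    inner ℂ (pureTensor x y) (pureTensor x' y') = inner ℂ x x' * inner ℂ y y' := by
  rw [pureTensor, pureTensor, UniformSpace.Completion.inner_coe, TensorProduct.inner_tmul]

theorem opTensor_pureTensor (S : BOp E) (T : BOp F) (x : E) (y : F) :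
    opTensor S T (pureTensor x y) = pureTensor (S x) (T y) :=
  opTensor_tmul S T x y

theorem hilbertTensor_ext {G : Type*} [NormedAddCommGroup G] [NormedSpace ℂ G]
    {P Q : HilbertTensor E F →L[ℂ] G} (h : ∀ x y, P (pureTensor x y) = Q (pureTensor x y)) :
    P = Q := by
  ext z
  induction z using UniformSpace.Completion.induction_on with
  | hp => exact isClosed_eq P.continuous Q.continuous
  | ih a =>
    induction a using TensorProduct.induction_on with
    | zero => rw [UniformSpace.Completion.coe_zero, map_zero, map_zero]
    | tmul x y => exact h x y
    | add a b ha hb => rw [UniformSpace.Completion.coe_add, map_add, map_add, ha, hb]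

theorem opTensor_mul (S S' : BOp E) (T T' : BOp F) :
    opTensor (S * S') (T * T') = opTensor S T * opTensor S' T' :=
  hilbertTensor_ext fun x y => by simp only [opTensor_pureTensor, mul_apply_eq_comp]

theorem opTensor_one_one : opTensor (1 : BOp E) (1 : BOp F) = 1 :=
  hilbertTensor_ext fun x y => by simp only [opTensor_pureTensor, one_apply_eq_self]

theorem opTensor_add_left (S S' : BOp E) (T : BOp F) :
    opTensor (S + S') T = opTensor S T + opTensor S' T :=
  hilbertTensor_ext fun x y => by
    simp only [pureTensor, opTensor_tmul, add_apply, TensorProduct.add_tmul,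
      UniformSpace.Completion.coe_add]

theorem opTensor_add_right (S : BOp E) (T T' : BOp F) :
    opTensor S (T + T') = opTensor S T + opTensor S T' :=
  hilbertTensor_ext fun x y => by simp only [opTensor_pureTensor, add_apply, pureTensor_add]

theorem opTensor_smul_left (c : ℂ) (S : BOp E) (T : BOp F) :
    opTensor (c • S) T = c • opTensor S T :=
  hilbertTensor_ext fun x y => by
    simp only [pureTensor, opTensor_tmul, smul_apply, ← UniformSpace.Completion.coe_smul,
      TensorProduct.smul_tmul']

theorem opTensor_smul_right (c : ℝ) (S : BOp E) (T : BOp F) :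
    opTensor S (c • T) = c • opTensor S T := by
  rw [← Complex.coe_smul, ← Complex.coe_smul]
  exact hilbertTensor_ext fun x y => by
    simp only [pureTensor, opTensor_tmul, smul_apply, ← UniformSpace.Completion.coe_smul,
      TensorProduct.tmul_smul]

theorem opTensor_sum_left {ι : Type*} (s : Finset ι) (S : ι → BOp E) (T : BOp F) :
    opTensor (∑ i ∈ s, S i) T = ∑ i ∈ s, opTensor (S i) T := by
  let φ : BOp E →+ BOp (HilbertTensor E F) :=
    AddMonoidHom.mk' (opTensor · T) (opTensor_add_left · · T)
  exact map_sum φ S s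

theorem opTensor_sum_right {ι : Type*} (s : Finset ι) (S : BOp E) (T : ι → BOp F) :
    opTensor S (∑ i ∈ s, T i) = ∑ i ∈ s, opTensor S (T i) := by
  let φ : BOp F →+ BOp (HilbertTensor E F) :=
    AddMonoidHom.mk' (opTensor S) (opTensor_add_right S)
  exact map_sum φ T s

theorem star_opTensor [CompleteSpace E] [CompleteSpace F] (S : BOp E) (T : BOp F) :
    star (opTensor S T) = opTensor (star S) (star T) :=
  hilbertTensor_ext fun x y => by
    refine ext_inner_right ℂ fun w => DFunLike.congr_fun (f := innerSL ℂ _) (g := innerSL ℂ _)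
      (hilbertTensor_ext fun x' y' => ?_) w
    rw [innerSL_apply_apply, innerSL_apply_apply, ContinuousLinearMap.star_eq_adjoint,
      ContinuousLinearMap.adjoint_inner_left, opTensor_pureTensor, opTensor_pureTensor,
      inner_pureTensor, inner_pureTensor, ContinuousLinearMap.star_eq_adjoint,
      ContinuousLinearMap.star_eq_adjoint, ContinuousLinearMap.adjoint_inner_left,
      ContinuousLinearMap.adjoint_inner_left]

theorem opTensor_nonneg [CompleteSpace E] [CompleteSpace F] {S : BOp E} {T : BOp F}
    (hS : 0 ≤ S) (hT : 0 ≤ T) : 0 ≤ opTensor S T := by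
  have hsq : opTensor S T
      = star (opTensor (CFC.sqrt S) (CFC.sqrt T)) * opTensor (CFC.sqrt S) (CFC.sqrt T) := by
    rw [star_opTensor, ← opTensor_mul, (IsSelfAdjoint.of_nonneg (CFC.sqrt_nonneg S)).star_eq,
      (IsSelfAdjoint.of_nonneg (CFC.sqrt_nonneg T)).star_eq, CFC.sqrt_mul_sqrt_self S hS,
      CFC.sqrt_mul_sqrt_self T hT]
  rw [hsq]
  exact star_mul_self_nonneg _

theorem opTensor_le_opTensor_left [CompleteSpace E] [CompleteSpace F] {S S' : BOp E} {T : BOp F}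
    (hS : S ≤ S') (hT : 0 ≤ T) : opTensor S T ≤ opTensor S' T := by
  have h := opTensor_add_left S (S' - S) T
  rw [add_sub_cancel] at h
  rw [h]
  exact le_add_of_nonneg_right (opTensor_nonneg (sub_nonneg.2 hS) hT)

theorem opTensor_le_opTensor_right [CompleteSpace E] [CompleteSpace F] {S : BOp E} {T T' : BOp F}
    (hS : 0 ≤ S) (hT : T ≤ T') : opTensor S T ≤ opTensor S T' := by
  have h := opTensor_add_right S T (T' - T)
  rw [add_sub_cancel] at h
  rw [h]
  exact le_add_of_nonneg_right (opTensor_nonneg hS (sub_nonneg.2 hT))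

theorem nonneg_of_opTensor_one_nonneg {e : E} (he : ‖e‖ = 1) {T : BOp F}
    (h : 0 ≤ opTensor (1 : BOp E) T) : 0 ≤ T := by
  have hpos := (ContinuousLinearMap.nonneg_iff_isPositive _).1 h
  rw [ContinuousLinearMap.nonneg_iff_isPositive, ContinuousLinearMap.isPositive_iff_complex]
  intro x
  have hx := hpos.inner_nonneg_left (pureTensor e x)
  rw [opTensor_pureTensor, inner_pureTensor, one_apply_eq_self, inner_self_eq_norm_sq_to_K, he,
    RCLike.ofReal_one, one_pow, one_mul, Complex.le_def] at hx
  exact ⟨Complex.ext rfl hx.2, hx.1⟩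

theorem inner_sum_pureTensor {ι : Type*} [DecidableEq ι] {e : ι → E} (he : Orthonormal ℂ e)
    (s t : Finset ι) (y y' : ι → F) :
    inner ℂ (∑ i ∈ s, pureTensor (e i) (y i)) (∑ i ∈ t, pureTensor (e i) (y' i))
      = ∑ i ∈ s ∩ t, inner ℂ (y i) (y' i) := by
  simp only [sum_inner, inner_sum, inner_pureTensor, orthonormal_iff_ite.1 he, ite_mul, one_mul,
    zero_mul, Finset.sum_ite_eq', Finset.sum_ite_mem, Finset.inter_comm]

theorem exists_orthonormal_expansion (u v : E ⊗[ℂ] F) :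
    ∃ (m : ℕ) (e : Fin m → E) (x y : Fin m → F), Orthonormal ℂ e ∧
      (u : HilbertTensor E F) = ∑ i, pureTensor (e i) (x i) ∧
      (v : HilbertTensor E F) = ∑ i, pureTensor (e i) (y i) := by
  obtain ⟨V, _, hV⟩ := TensorProduct.exists_finite_submodule_left_of_setFinite
    ({u, v} : Set (E ⊗[ℂ] F)) (Set.toFinite _)
  rw [Set.insert_subset_iff, Set.singleton_subset_iff] at hV
  obtain ⟨⟨u', rfl⟩, v', rfl⟩ := hV
  let b := stdOrthonormalBasis ℂ V
  have hb : ∀ w : V ⊗[ℂ] F, ∃ x : _ → F,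
      (V.subtype.rTensor F w : HilbertTensor E F) = ∑ i, pureTensor (b i : E) (x i) := fun w => by
    obtain ⟨c, rfl⟩ := TensorProduct.eq_repr_basis_left b.toBasis w
    refine ⟨c, ?_⟩
    simp only [OrthonormalBasis.coe_toBasis, Finsupp.sum_fintype, TensorProduct.tmul_zero,
      implies_true, map_sum, LinearMap.rTensor_tmul, Submodule.subtype_apply, pureTensor]
    exact map_sum (UniformSpace.Completion.toComplL (𝕜 := ℂ) (E := E ⊗[ℂ] F)) _ _
  obtain ⟨x, hx⟩ := hb u'
  obtain ⟨y, hy⟩ := hb v'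
  exact ⟨_, fun i => b i, x, y, b.orthonormal.comp_linearIsometry V.subtypeₗᵢ, hx, hy⟩

end OpTensor

section IsPosBlock

variable {H : Type*} [NormedAddCommGroup H] [InnerProductSpace ℂ H]

/-- Positivity of the operator matrix `[[P, -C*], [-C, Q]]` on `H ⊕ H`, as a condition on its
quadratic form. Replacing `y` by `-y` shows that the sign of `C` is immaterial. -/
def IsPosBlock (P C Q : BOp H) : Prop :=
  ∀ x y, 2 * (inner ℂ y (C x)).re ≤ (inner ℂ x (P x)).re + (inner ℂ y (Q y)).re

theorem le_mul_of_forall_two_mul_le {σ c q : ℝ} (hσ : 0 ≤ σ) (hc : 0 ≤ c)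
    (h : ∀ t : ℝ, 2 * t * σ ≤ q + t ^ 2 * (c * σ)) : σ ≤ c * q := by
  have hq : 0 ≤ q := by simpa using h 0
  have hdiscrim : discrim (c * σ) (-2 * σ) q ≤ 0 :=
    discrim_le_zero fun t => by linarith [h t]
  rw [discrim] at hdiscrim
  rcases hσ.eq_or_lt with rfl | hpos
  · positivity
  · nlinarith

namespace IsPosBlock

variable {P C Q P' C' Q' : BOp H}

theorem add (h : IsPosBlock P C Q) (h' : IsPosBlock P' C' Q') :
    IsPosBlock (P + P') (C + C') (Q + Q') := fun x y => by
  simp only [add_apply, inner_add_right, Complex.add_re]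
  linarith [h x y, h' x y]

theorem smul (h : IsPosBlock P C Q) {c : ℝ} (hc : 0 ≤ c) :
    IsPosBlock (c • P) (c • C) (c • Q) := fun x y => by
  simp only [re_inner_smul_apply]
  linarith [mul_le_mul_of_nonneg_left (h x y) hc]

theorem mono (h : IsPosBlock P C Q) (hP : P ≤ P') (hQ : Q ≤ Q') : IsPosBlock P' C Q' :=
  fun x y => (h x y).trans (add_le_add (re_inner_mono hP x) (re_inner_mono hQ y))

theorem sum {ι : Type*} {s : Finset ι} {P C Q : ι → BOp H}
    (h : ∀ i ∈ s, IsPosBlock (P i) (C i) (Q i)) :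
    IsPosBlock (∑ i ∈ s, P i) (∑ i ∈ s, C i) (∑ i ∈ s, Q i) := fun x y => by
  simp only [inner_sum_apply, Complex.re_sum, Finset.mul_sum, ← Finset.sum_add_distrib]
  exact Finset.sum_le_sum fun i hi => h i hi x y

theorem hasSum {ι : Type*} {P C Q : ι → BOp H} {P' C' Q' : BOp H} (hP : HasSum P P')
    (hC : HasSum C C') (hQ : HasSum Q Q') (h : ∀ i, IsPosBlock (P i) (C i) (Q i)) :
    IsPosBlock P' C' Q' := fun x y => by
  have eval : ∀ {T : ι → BOp H} {T' : BOp H}, HasSum T T' → ∀ u v : H,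
      HasSum (fun i => (inner ℂ u (T i v)).re) (inner ℂ u (T' v)).re := fun hT u v =>
    hT.mapL (Complex.reCLM ∘L ((innerSL ℂ u).restrictScalars ℝ) ∘L
      ((ContinuousLinearMap.apply ℂ H v).restrictScalars ℝ))
  exact hasSum_le (fun i => h i x y) ((eval hC y x).mul_left 2)
    ((eval hP x x).add (eval hQ y y))

theorem norm_le (h : IsPosBlock P C Q) : ‖C‖ ≤ √(‖Q‖ * ‖P‖) := by
  refine C.opNorm_le_bound (by positivity) fun x => ?_
  have hsq : ‖C x‖ ^ 2 ≤ ‖Q‖ * (‖P‖ * ‖x‖ ^ 2) := by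
    refine le_mul_of_forall_two_mul_le (sq_nonneg _) (norm_nonneg _) fun t => ?_
    have htest := h x ((t : ℂ) • C x)
    simp only [map_smul, inner_smul_left, inner_smul_right, Complex.conj_ofReal,
      Complex.re_ofReal_mul] at htest
    have hself : (inner ℂ (C x) (C x)).re = ‖C x‖ ^ 2 := inner_self_eq_norm_sq (𝕜 := ℂ) (C x)
    rw [hself] at htest
    have hP := re_inner_le_norm_mul_sq P x
    have hQ := mul_le_mul_of_nonneg_left (re_inner_le_norm_mul_sq Q (C x)) (sq_nonneg t)
    linarith
  calc ‖C x‖ ≤ √(‖Q‖ * ‖P‖ * ‖x‖ ^ 2) := Real.le_sqrt_of_sq_le (by linarith)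
    _ = √(‖Q‖ * ‖P‖) * ‖x‖ := by
      rw [Real.sqrt_mul' _ (sq_nonneg _), Real.sqrt_sq (norm_nonneg x)]

theorem of_nonneg (hP : 0 ≤ P) : IsPosBlock P P P := fun x y => by
  have hsub := re_inner_nonneg hP (x - y)
  have hsymm : (inner ℂ x (P y)).re = (inner ℂ y (P x)).re := by
    have hPsymm : inner ℂ (P x) y = inner ℂ x (P y) :=
      ((ContinuousLinearMap.nonneg_iff_isPositive P).1 hP).isSymmetric x y
    rw [← hPsymm, ← inner_conj_symm, Complex.conj_re]
  simp only [map_sub, inner_sub_left, inner_sub_right, Complex.sub_re, hsymm] at hsub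
  linarith

theorem conj [CompleteSpace H] (h : IsPosBlock P C Q) (U V : BOp H) :
    IsPosBlock (star U * P * U) (star V * C * U) (star V * Q * V) := fun x y => by
  simpa only [mul_assoc, mul_apply_eq_comp, inner_star_apply] using h (U x) (V y)

theorem opTensor_one {E : Type*} [NormedAddCommGroup E] [InnerProductSpace ℂ E]
    (h : IsPosBlock P C Q) :
    IsPosBlock (opTensor (1 : BOp E) P) (opTensor 1 C) (opTensor 1 Q) := fun u v => by
  induction u, v using UniformSpace.Completion.induction_on₂ with
  | hp => exact isClosed_le (by fun_prop) (by fun_prop)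
  | ih a b =>
    obtain ⟨m, e, x, y, he, hx, hy⟩ := exists_orthonormal_expansion a b
    simp only [hx, hy, map_sum, opTensor_pureTensor, one_apply_eq_self, inner_sum_pureTensor he,
      Complex.re_sum, Finset.mul_sum, Finset.inter_self, ← Finset.sum_add_distrib]
    exact Finset.sum_le_sum fun i _ => h (x i) (y i)

theorem sum_opTensor {ι E : Type*} [NormedAddCommGroup E] [InnerProductSpace ℂ E]
    [CompleteSpace E] [CompleteSpace H] {s : Finset ι} {S T : ι → BOp E} {B : BOp H}
    {C : ι → BOp H} (hS : ∑ i ∈ s, S i * star (S i) ≤ 1) (hT : ∑ i ∈ s, star (T i) * T i ≤ 1)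
    (hB : 0 ≤ B) (h : ∀ i ∈ s, IsPosBlock B (C i) B) :
    IsPosBlock (opTensor 1 B) (∑ i ∈ s, opTensor (S i * T i) (C i)) (opTensor 1 B) := by
  have hterm : ∀ i ∈ s, IsPosBlock (opTensor (star (T i) * T i) B) (opTensor (S i * T i) (C i))
      (opTensor (S i * star (S i)) B) := fun i hi => by
    have hi' := ((h i hi).opTensor_one (E := E)).conj (opTensor (T i) 1) (opTensor (star (S i)) 1)
    simpa only [star_opTensor, ← opTensor_mul, star_star, star_one, one_mul, mul_one] using hi'
  refine (IsPosBlock.sum hterm).mono ?_ ?_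
  · rw [← opTensor_sum_left]
    exact opTensor_le_opTensor_left hT hB
  · rw [← opTensor_sum_left]
    exact opTensor_le_opTensor_left hS hB

end IsPosBlock

end IsPosBlock

section IsPosColumn

variable {ι H : Type*} [NormedAddCommGroup H] [InnerProductSpace ℂ H]

/-- Positivity of the operator matrix on `H ⊕ ⨁_{i ∈ s} H` whose first column is `P` on the
diagonal and `-C_i` below it, and whose remaining diagonal entries all equal `Q`. -/
def IsPosColumn (s : Finset ι) (P : BOp H) (C : ι → BOp H) (Q : BOp H) : Prop :=
  ∀ (x : H) (y : ι → H), 2 * ∑ i ∈ s, (inner ℂ (y i) (C i x)).re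
    ≤ (inner ℂ x (P x)).re + ∑ i ∈ s, (inner ℂ (y i) (Q (y i))).re

namespace IsPosColumn

variable {s : Finset ι} {P Q : BOp H} {C : ι → BOp H}

theorem isPosBlock (h : IsPosColumn s P C Q) {i : ι} (hi : i ∈ s) : IsPosBlock P (C i) Q := by
  classical
  intro x y
  have htest := h x (Pi.single i y)
  rwa [Finset.sum_eq_single_of_mem i hi, Finset.sum_eq_single_of_mem i hi,
    Pi.single_eq_same] at htest
  all_goals
    intro j _ hj
    simp [Pi.single_eq_of_ne hj]

theorem re_inner_nonneg (h : IsPosColumn s P C Q) (x : H) : 0 ≤ (inner ℂ x (P x)).re := by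
  simpa using h x 0

variable [CompleteSpace H]

theorem sum_star_mul_mul_le (h : IsPosColumn s P C Q) (hP : IsSelfAdjoint P) {T : BOp H}
    (hT : 0 ≤ T) {c : ℝ} (hc : 0 ≤ c) (hTQ : T * Q * T ≤ c • T) :
    ∑ i ∈ s, star (C i) * T * C i ≤ c • P := by
  refine le_of_re_inner_le (isSelfAdjoint_sum _ fun i _ =>
    IsSelfAdjoint.of_nonneg (star_left_conjugate_nonneg hT _))
    ((IsSelfAdjoint.all c).smul hP) fun x => ?_
  have hTsymm := (IsSelfAdjoint.of_nonneg hT).star_eq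
  have hσ : (inner ℂ x ((∑ i ∈ s, star (C i) * T * C i) x)).re
      = ∑ i ∈ s, (inner ℂ (C i x) (T (C i x))).re := by
    simp only [inner_sum_apply, Complex.re_sum, mul_assoc, mul_apply_eq_comp, inner_star_apply]
  rw [hσ, re_inner_smul_apply]
  refine le_mul_of_forall_two_mul_le
    (Finset.sum_nonneg fun i _ => NCBohr.re_inner_nonneg hT _) hc fun t => ?_
  have htest := h x fun i => (t : ℂ) • T (C i x)
  have hdiag : ∀ z : H, (inner ℂ (T z) (Q (T z))).re ≤ c * (inner ℂ z (T z)).re := fun z => by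
    rw [← re_inner_smul_apply, ← inner_star_apply, hTsymm]
    exact re_inner_mono hTQ z
  have hcross : ∀ z : H, (inner ℂ (T z) z).re = (inner ℂ z (T z)).re := fun z => by
    rw [← inner_star_apply, hTsymm]
  simp only [map_smul, inner_smul_left, inner_smul_right, Complex.conj_ofReal,
    Complex.re_ofReal_mul, hcross, ← Finset.mul_sum] at htest
  have hsum := mul_le_mul_of_nonneg_left
    (Finset.sum_le_sum fun i (_ : i ∈ s) => hdiag (C i x)) (mul_self_nonneg t)
  rw [← Finset.mul_sum] at hsum
  linarith

end IsPosColumn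

end IsPosColumn

section Words

variable {n : ℕ} {E : Type*} [NormedAddCommGroup E] [InnerProductSpace ℂ E]

theorem words_zero : words n 0 = {1} := by
  ext α
  rw [mem_words, Finset.mem_singleton, FreeMonoid.length_eq_zero]

theorem disjoint_words {j k : ℕ} (h : j ≠ k) : Disjoint (words n j) (words n k) :=
  Finset.disjoint_left.2 fun _ hj hk => h ((mem_words.1 hj).symm.trans (mem_words.1 hk))

theorem sum_words_succ {G : Type*} [AddCommMonoid G] (k : ℕ) (f : FreeMonoid (Fin n) → G) :
    ∑ α ∈ words n (k + 1), f α = ∑ i, ∑ β ∈ words n k, f (FreeMonoid.of i * β) := by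
  simp only [words, Finset.sum_map, Function.Embedding.coeFn_mk]
  rw [← Fintype.sum_equiv (Fin.consEquiv fun _ => Fin n)
    (fun p => f (FreeMonoid.of p.1 * FreeMonoid.ofList (List.ofFn p.2))) _ fun p => ?_,
    Fintype.sum_prod_type]
  congr 1
  simp [Fin.consEquiv, List.ofFn_succ]

theorem evalWord_one (T : Fin n → BOp E) : evalWord T 1 = 1 := map_one _

theorem evalWord_of_mul (T : Fin n → BOp E) (i : Fin n) (β : FreeMonoid (Fin n)) :
    evalWord T (FreeMonoid.of i * β) = T i * evalWord T β := by
  simp only [evalWord, map_mul, FreeMonoid.lift_eval_of]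

theorem evalWord_smul (c : ℂ) (T : Fin n → BOp E) (α : FreeMonoid (Fin n)) :
    evalWord (fun i => c • T i) α = c ^ α.length • evalWord T α := by
  induction α using FreeMonoid.inductionOn' with
  | one => simp only [evalWord_one, FreeMonoid.length_one, pow_zero, one_smul]
  | of_mul i β ih =>
    rw [evalWord_of_mul, evalWord_of_mul, ih, FreeMonoid.length_mul, FreeMonoid.length_of,
      smul_mul_smul_comm, pow_add, pow_one]

theorem evalWord_opTensor {F : Type*} [NormedAddCommGroup F] [InnerProductSpace ℂ F]
    (S : Fin n → BOp E) (T : Fin n → BOp F) (α : FreeMonoid (Fin n)) :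
    evalWord (fun i => opTensor (S i) (T i)) α = opTensor (evalWord S α) (evalWord T α) := by
  induction α using FreeMonoid.inductionOn' with
  | one => simp only [evalWord_one, opTensor_one_one]
  | of_mul i β ih => simp only [evalWord_of_mul, ih, opTensor_mul]

variable [CompleteSpace E]

theorem sum_evalWord_mul_star_le_one {T : Fin n → BOp E} (h : ∑ i, T i * star (T i) ≤ 1)
    (k : ℕ) : ∑ α ∈ words n k, evalWord T α * star (evalWord T α) ≤ 1 := by
  induction k with
  | zero => simp only [words_zero, Finset.sum_singleton, evalWord_one, star_one, mul_one, le_refl]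
  | succ k ih =>
    calc ∑ α ∈ words n (k + 1), evalWord T α * star (evalWord T α)
        = ∑ i, T i * (∑ β ∈ words n k, evalWord T β * star (evalWord T β)) * star (T i) := by
          simp only [sum_words_succ, evalWord_of_mul, star_mul, Finset.mul_sum, Finset.sum_mul,
            mul_assoc]
      _ ≤ ∑ i, T i * star (T i) := Finset.sum_le_sum fun i _ => by
          simpa only [mul_one] using star_right_conjugate_le_conjugate ih (T i)
      _ ≤ 1 := h

theorem sum_star_evalWord_mul_le_one {T : Fin n → BOp E} (h : ∑ i, star (T i) * T i ≤ 1)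
    (k : ℕ) : ∑ α ∈ words n k, star (evalWord T α) * evalWord T α ≤ 1 := by
  induction k with
  | zero => simp only [words_zero, Finset.sum_singleton, evalWord_one, star_one, mul_one, le_refl]
  | succ k ih =>
    calc ∑ α ∈ words n (k + 1), star (evalWord T α) * evalWord T α
        = ∑ β ∈ words n k, star (evalWord T β) * (∑ i, star (T i) * T i) * evalWord T β := by
          rw [sum_words_succ, Finset.sum_comm]
          simp only [evalWord_of_mul, star_mul, Finset.mul_sum, Finset.sum_mul, mul_assoc]
      _ ≤ ∑ β ∈ words n k, star (evalWord T β) * evalWord T β := Finset.sum_le_sum fun β _ => by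
          simpa only [mul_one] using star_left_conjugate_le_conjugate h (evalWord T β)
      _ ≤ 1 := ih

theorem rowOp_comp_adjoint (T : Fin n → BOp E) :
    rowOp T ∘L ContinuousLinearMap.adjoint (rowOp T) = ∑ i, T i * star (T i) := by
  have hproj : ∀ i x, ContinuousLinearMap.adjoint (rowOp T) x i = star (T i) x := fun i x => by
    refine ext_inner_left ℂ fun y => ?_
    have hsingle : rowOp T (PiLp.single 2 i y) = T i y := by
      rw [rowOp, sum_apply, Finset.sum_eq_single i]
      · simp
      · intro j _ hj
        simp [hj]
      · simp
    rw [inner_star_apply, ← hsingle, ← ContinuousLinearMap.adjoint_inner_right,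
      PiLp.inner_apply, Finset.sum_eq_single i]
    · simp
    · intro j _ hj
      simp [hj]
    · simp
  ext x
  simp only [rowOp, ContinuousLinearMap.comp_apply, sum_apply, mul_apply_eq_comp, ← hproj]
  rfl

theorem sum_mul_star_le_norm_rowOp (T : Fin n → BOp E) :
    ∑ i, T i * star (T i) ≤ (‖rowOp T‖ ^ 2) • (1 : BOp E) := by
  have hsa : IsSelfAdjoint (∑ i, T i * star (T i)) :=
    isSelfAdjoint_sum _ fun i _ => IsSelfAdjoint.mul_star_self (T i)
  refine (IsSelfAdjoint.le_algebraMap_norm_self hsa).trans ?_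
  rw [← Algebra.algebraMap_eq_smul_one]
  refine algebraMap_mono _ ?_
  rw [← rowOp_comp_adjoint, sq]
  refine (ContinuousLinearMap.opNorm_comp_le _ _).trans_eq ?_
  rw [LinearIsometryEquiv.norm_map]

end Words

section Creation

variable {n : ℕ}

theorem inner_creation (i j : Fin n) (φ ψ : FockSpace n) :
    inner ℂ (creation i φ) (creation j ψ) = if i = j then inner ℂ φ ψ else 0 := by
  split_ifs with hij
  · subst hij
    have hnorm : ∀ χ : FockSpace n, ‖creation i χ‖ = ‖χ‖ := fun χ => by
      rw [creation, LinearIsometry.coe_toContinuousLinearMap, LinearIsometry.norm_map]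
    exact LinearIsometry.inner_map_map ⟨(creation i).toLinearMap, hnorm⟩ φ ψ
  · rw [lp.inner_eq_tsum]
    refine (tsum_congr fun α => ?_).trans tsum_zero
    rw [creation_apply, creation_apply]
    by_cases hi : ∃ β, FreeMonoid.of i * β = α
    · obtain ⟨β, rfl⟩ := hi
      rw [creationFun_of_ne j, inner_zero_right]
      rintro ⟨γ, hγ⟩
      have hlist := congrArg FreeMonoid.toList hγ
      simp only [FreeMonoid.toList_mul, FreeMonoid.toList_of, List.singleton_append,
        List.cons.injEq] at hlist
      exact hij hlist.1.symm
    · rw [creationFun_of_ne i _ α hi, inner_zero_left]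

open Classical in
/-- The orthonormal basis vectors `e_α` of the Fock space. -/
def fockBasis (α : FreeMonoid (Fin n)) : FockSpace n := lp.single 2 α (1 : ℂ)

theorem orthonormal_fockBasis : Orthonormal ℂ (fockBasis (n := n)) := by
  classical
  rw [orthonormal_iff_ite]
  intro α β
  rw [fockBasis, lp.inner_single_left, fockBasis, lp.coeFn_single, Pi.single_apply]
  simp

theorem creation_fockBasis (i : Fin n) (β : FreeMonoid (Fin n)) :
    creation i (fockBasis β) = fockBasis (FreeMonoid.of i * β) := by
  classical
  refine lp.ext (funext fun α => ?_)
  rw [creation_apply, fockBasis, fockBasis, lp.coeFn_single, lp.coeFn_single]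
  by_cases h : ∃ γ, FreeMonoid.of i * γ = α
  · obtain ⟨γ, rfl⟩ := h
    rw [creationFun_of_mul, Pi.single_apply, Pi.single_apply]
    simp only [mul_right_inj]
  · rw [creationFun_of_ne i _ α h, Pi.single_apply, if_neg]
    rintro rfl
    exact h ⟨β, rfl⟩

theorem sum_mul_star_le_one_of_inner {E : Type*} [NormedAddCommGroup E] [InnerProductSpace ℂ E]
    [CompleteSpace E] {S : Fin n → BOp E}
    (hS : ∀ i j x y, inner ℂ (S i x) (S j y) = if i = j then inner ℂ x y else 0) :
    ∑ i, S i * star (S i) ≤ 1 := by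
  have hstar : ∀ i j, star (S i) * S j = if i = j then 1 else 0 := fun i j => by
    ext y
    refine ext_inner_left ℂ fun x => ?_
    rw [mul_apply_eq_comp, inner_star_apply, hS]
    split_ifs
    · rw [one_apply_eq_self]
    · rw [zero_apply, inner_zero_right]
  refine IsStarProjection.le_one ⟨?_, isSelfAdjoint_sum _ fun i _ => .mul_star_self (S i)⟩
  have hterm : ∀ i j, S i * star (S i) * (S j * star (S j))
      = if i = j then S i * star (S j) else 0 := fun i j => by
    rw [mul_assoc, ← mul_assoc (star (S i)), hstar, ite_mul, mul_ite, one_mul, zero_mul, mul_zero]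
  simp only [IsIdempotentElem, Finset.sum_mul_sum, hterm, Finset.sum_ite_eq, Finset.mem_univ,
    if_true]

theorem smul_mem_opBall {E : Type*} [NormedAddCommGroup E] [InnerProductSpace ℂ E]
    [CompleteSpace E] {S : Fin n → BOp E} (hS : ∑ i, S i * star (S i) ≤ 1) {r : ℝ}
    (h0 : 0 ≤ r) (h1 : r < 1) : (fun i => (r : ℂ) • S i) ∈ opBall n E := by
  have hnorm : ‖∑ i, S i * star (S i)‖ ≤ 1 := (CStarAlgebra.norm_le_one_iff_of_nonneg _
    (Finset.sum_nonneg fun i _ => mul_star_self_nonneg (S i))).2 hS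
  have hsmul : ∑ i, (r : ℂ) • S i * star ((r : ℂ) • S i)
      = ((r : ℂ) * r) • ∑ i, S i * star (S i) := by
    simp only [star_smul, smul_mul_smul_comm, Finset.smul_sum, Complex.star_def,
      Complex.conj_ofReal]
  rw [opBall, Set.mem_ofPred_eq, hsmul, norm_smul, norm_mul, Complex.norm_of_nonneg h0]
  nlinarith [norm_nonneg (∑ i, S i * star (S i)), mul_nonneg h0 h0]

/-- The inner product space structure on a universe lift, needed because the hypotheses on `F`
quantify over Hilbert spaces of a fixed universe that need not contain the Fock space. -/
abbrev uliftInnerProductSpace (E : Type*) [NormedAddCommGroup E] [InnerProductSpace ℂ E] :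
    InnerProductSpace ℂ (ULift.{v} E) where
  inner x y := inner ℂ x.down y.down
  norm_sq_eq_re_inner x := norm_sq_eq_re_inner x.down
  conj_inner_symm x y := inner_conj_symm x.down y.down
  add_left x y z := inner_add_left x.down y.down z.down
  smul_left x y c := inner_smul_left x.down y.down c

theorem exists_fock_model (n : ℕ) : ∃ (E : Type v) (_ : NormedAddCommGroup E)
    (_ : InnerProductSpace ℂ E) (_ : CompleteSpace E) (S : Fin n → BOp E)
    (e : FreeMonoid (Fin n) → E), Orthonormal ℂ e ∧ (∀ i α, S i (e α) = e (FreeMonoid.of i * α)) ∧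
      ∑ i, S i * star (S i) ≤ 1 := by
  let := uliftInnerProductSpace.{v} (FockSpace n)
  let U : ULift.{v} (FockSpace n) ≃ₗᵢ[ℂ] FockSpace n := LinearIsometryEquiv.ulift ℂ (FockSpace n)
  let S : Fin n → BOp (ULift.{v} (FockSpace n)) := fun i =>
    (U.symm : FockSpace n →L[ℂ] ULift.{v} (FockSpace n)) ∘L creation i ∘L
      (U : ULift.{v} (FockSpace n) →L[ℂ] FockSpace n)
  refine ⟨ULift.{v} (FockSpace n), inferInstance, inferInstance, inferInstance, S,
    U.symm ∘ fockBasis, orthonormal_fockBasis.comp_linearIsometryEquiv U.symm, fun i α => ?_,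
    sum_mul_star_le_one_of_inner fun i j x y => ?_⟩
  · exact congrArg U.symm (creation_fockBasis i α)
  · exact inner_creation i j x.down y.down

end Creation

section HomVector

variable {n : ℕ} {H E : Type*} [NormedAddCommGroup H] [InnerProductSpace ℂ H]
  [NormedAddCommGroup E] [InnerProductSpace ℂ E] {A : FreeMonoid (Fin n) → BOp H}

theorem homPart_zero (X : Fin n → BOp E) : homPart A X 0 = opTensor 1 (A 1) := by
  rw [homPart, words_zero, Finset.sum_singleton, evalWord_one]

theorem homPart_smul (c : ℂ) (X : Fin n → BOp E) (k : ℕ) :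
    homPart A (fun i => c • X i) k = c ^ k • homPart A X k := by
  rw [homPart, homPart, Finset.smul_sum]
  refine Finset.sum_congr rfl fun α hα => ?_
  rw [evalWord_smul, mem_words.1 hα, opTensor_smul_left]

theorem hasValue_zero : HasValue A (0 : Fin n → BOp E) (opTensor 1 (A 1)) := by
  have hzero : ∀ k ≠ 0, homPart A (0 : Fin n → BOp E) k = 0 := fun k hk => by
    have hX : (0 : Fin n → BOp E) = fun _ => (0 : ℂ) • (0 : BOp E) :=
      funext fun _ => (zero_smul ℂ _).symm
    rw [hX, homPart_smul 0 fun _ => 0, zero_pow hk, zero_smul]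
  have hsum := hasSum_single 0 hzero
  rw [homPart_zero] at hsum
  exact hsum.tendsto_sum_nat

theorem HasValue.inner_eq {X : Fin n → BOp E} {L : BOp (HilbertTensor E H)}
    (hL : HasValue A X L) {u v : HilbertTensor E H} {m : ℕ}
    (h : ∀ k ≠ m, inner ℂ v (homPart A X k u) = 0) :
    inner ℂ v (L u) = inner ℂ v (homPart A X m u) := by
  have hlim : Filter.Tendsto
      (fun N => inner ℂ v ((∑ k ∈ Finset.range N, homPart A X k) u)) Filter.atTop
      (𝓝 (inner ℂ v (L u))) :=
    tendsto_const_nhds.inner (((ContinuousLinearMap.apply ℂ _ u).continuous.tendsto L).comp hL)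
  refine tendsto_nhds_unique hlim (tendsto_const_nhds.congr' ?_)
  filter_upwards [Filter.eventually_gt_atTop m] with N hN
  rw [inner_sum_apply, Finset.sum_eq_single_of_mem m (Finset.mem_range.2 hN) fun k _ => h k]

/-- The vector `∑_{|α| = k} e_α ⊗ y_α`, homogeneous of degree `k` in the grading of the Fock space
by word length. -/
def homVector (e : FreeMonoid (Fin n) → E) (k : ℕ) (y : FreeMonoid (Fin n) → H) :
    HilbertTensor E H :=
  ∑ α ∈ words n k, pureTensor (e α) (y α)

variable {e : FreeMonoid (Fin n) → E} {S : Fin n → BOp E}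

theorem inner_homVector (he : Orthonormal ℂ e) (k : ℕ) (y y' : FreeMonoid (Fin n) → H) :
    inner ℂ (homVector e k y) (homVector e k y') = ∑ α ∈ words n k, inner ℂ (y α) (y' α) := by
  classical
  rw [homVector, homVector, inner_sum_pureTensor he, Finset.inter_self]

theorem inner_homVector_of_ne (he : Orthonormal ℂ e) {j k : ℕ} (h : j ≠ k)
    (y y' : FreeMonoid (Fin n) → H) : inner ℂ (homVector e j y) (homVector e k y') = 0 := by
  classical
  rw [homVector, homVector, inner_sum_pureTensor he,
    Finset.disjoint_iff_inter_eq_empty.1 (disjoint_words h), Finset.sum_empty]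

theorem evalWord_apply_of_shift (hS : ∀ i α, S i (e α) = e (FreeMonoid.of i * α))
    (α β : FreeMonoid (Fin n)) : evalWord S α (e β) = e (α * β) := by
  induction α using FreeMonoid.inductionOn' with
  | one => rw [evalWord_one, one_apply_eq_self, one_mul]
  | of_mul i α ih => rw [evalWord_of_mul, mul_apply_eq_comp, ih, hS, mul_assoc]

theorem homPart_apply_homVector (hS : ∀ i α, S i (e α) = e (FreeMonoid.of i * α)) (m k : ℕ)
    (y : FreeMonoid (Fin n) → H) : homPart A S m (homVector e k y)
      = ∑ α ∈ words n m, ∑ β ∈ words n k, pureTensor (e (α * β)) (A α (y β)) := by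
  rw [homPart, sum_apply]
  simp only [homVector, map_sum, opTensor_pureTensor, evalWord_apply_of_shift hS]

theorem homPart_apply_homVector_zero (hS : ∀ i α, S i (e α) = e (FreeMonoid.of i * α)) (m : ℕ)
    (x : H) :
    homPart A S m (homVector e 0 fun _ => x) = homVector e m fun α => A α x := by
  rw [homPart_apply_homVector hS, homVector]
  simp only [words_zero, Finset.sum_singleton, mul_one]

theorem homPart_zero_apply_homVector (k : ℕ) (y : FreeMonoid (Fin n) → H) :
    homPart A S 0 (homVector e k y) = homVector e k fun α => A 1 (y α) := by
  simp only [homPart_zero, homVector, map_sum, opTensor_pureTensor, one_apply_eq_self]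

theorem inner_homVector_homPart_of_ne (he : Orthonormal ℂ e)
    (hS : ∀ i α, S i (e α) = e (FreeMonoid.of i * α)) {j k m : ℕ} (h : j ≠ m + k)
    (y y' : FreeMonoid (Fin n) → H) :
    inner ℂ (homVector e j y) (homPart A S m (homVector e k y')) = 0 := by
  rw [homPart_apply_homVector hS, homVector]
  simp only [sum_inner, inner_sum]
  refine Finset.sum_eq_zero fun α hα => Finset.sum_eq_zero fun β hβ =>
    Finset.sum_eq_zero fun γ hγ => ?_
  have hne : γ ≠ α * β := by
    rintro rfl
    rw [mem_words] at hα hβ hγ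
    exact h (by rw [← hγ, FreeMonoid.length_mul, hα, hβ])
  rw [inner_pureTensor, he.2 hne, zero_mul]

theorem HasValue.inner_homVector_eq_zero_of_lt (he : Orthonormal ℂ e)
    (hS : ∀ i α, S i (e α) = e (FreeMonoid.of i * α)) {c : ℂ} {L : BOp (HilbertTensor E H)}
    (hL : HasValue A (fun i => c • S i) L) {j k : ℕ} (h : j < k) (y y' : FreeMonoid (Fin n) → H) :
    inner ℂ (homVector e j y) (L (homVector e k y')) = 0 := by
  have hvanish : ∀ m, inner ℂ (homVector e j y)
      (homPart A (fun i => c • S i) m (homVector e k y')) = 0 := fun m => by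
    rw [homPart_smul, smul_apply, inner_smul_right,
      inner_homVector_homPart_of_ne he hS (by omega), mul_zero]
  rw [hL.inner_eq (m := 0) fun m _ => hvanish m, hvanish]

theorem HasValue.inner_homVector_of_eq_add (he : Orthonormal ℂ e)
    (hS : ∀ i α, S i (e α) = e (FreeMonoid.of i * α)) {c : ℂ} {L : BOp (HilbertTensor E H)}
    (hL : HasValue A (fun i => c • S i) L) {j k m : ℕ} (h : j = m + k)
    (y y' : FreeMonoid (Fin n) → H) : inner ℂ (homVector e j y) (L (homVector e k y'))
      = c ^ m * inner ℂ (homVector e j y) (homPart A S m (homVector e k y')) := by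
  rw [hL.inner_eq (m := m) fun i hi => ?_, homPart_smul, smul_apply, inner_smul_right]
  rw [homPart_smul, smul_apply, inner_smul_right,
    inner_homVector_homPart_of_ne he hS (by omega), mul_zero]

theorem isPosColumn_of_realPart_le_one [CompleteSpace H] (he : Orthonormal ℂ e)
    (hS : ∀ i α, S i (e α) = e (FreeMonoid.of i * α)) {r : ℝ} {L : BOp (HilbertTensor E H)}
    (hL : HasValue A (fun i => (r : ℂ) • S i) L)
    (hRe : (realPart L : BOp (HilbertTensor E H)) ≤ 1) {k : ℕ} (hk : 1 ≤ k) :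
    IsPosColumn (words n k) ((2 : ℝ) • (1 - A 1)) (fun α => (r ^ k) • A α)
      ((2 : ℝ) • (1 - A 1)) := fun x y => by
  set u := homVector e 0 fun _ => x with hu
  set v := homVector e k y with hv
  have huv : inner ℂ u (L v) = 0 := hL.inner_homVector_eq_zero_of_lt he hS hk _ _
  have hvu : inner ℂ v (L u) = (r : ℂ) ^ k * ∑ α ∈ words n k, inner ℂ (y α) (A α x) := by
    rw [hv, hu, hL.inner_homVector_of_eq_add he hS (add_zero k).symm,
      homPart_apply_homVector_zero hS, inner_homVector he]
  have hdiag : ∀ (j : ℕ) (z : FreeMonoid (Fin n) → H),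
      inner ℂ (homVector e j z) (L (homVector e j z))
        = ∑ α ∈ words n j, inner ℂ (z α) (A 1 (z α)) := fun j z => by
    rw [hL.inner_homVector_of_eq_add he hS (zero_add j).symm, pow_zero, one_mul,
      homPart_zero_apply_homVector, inner_homVector he]
  have huv' : inner ℂ u v = 0 := inner_homVector_of_ne he (by omega) _ _
  have hvu' : inner ℂ v u = 0 := inner_homVector_of_ne he (by omega) _ _
  have htest := re_inner_mono hRe (u + v)
  rw [re_inner_realPart_apply] at htest
  simp only [one_apply_eq_self, map_add, inner_add_left, inner_add_right,
    huv, hvu, huv', hvu', add_zero, zero_add] at htest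
  rw [hu, hv, hdiag, hdiag, inner_homVector he, inner_homVector he, words_zero,
    Finset.sum_singleton, Finset.sum_singleton, ← Complex.ofReal_pow] at htest
  simp only [Complex.add_re, Complex.re_ofReal_mul, Complex.re_sum] at htest
  simp only [re_inner_smul_apply, sub_apply, one_apply_eq_self, inner_sub_right, Complex.sub_re,
    ← Finset.mul_sum, Finset.sum_sub_distrib]
  linarith

end HomVector

section Coefficients

variable {n : ℕ} {H : Type u} [NormedAddCommGroup H] [InnerProductSpace ℂ H]
  {A : FreeMonoid (Fin n) → BOp H}

theorem coeff_one_nonneg (hF0 : NonnegAtZero.{v, u} A) : 0 ≤ A 1 := by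
  obtain ⟨E, _, _, _, _, e, he, _⟩ := exists_fock_model.{v} n
  exact nonneg_of_opTensor_one_nonneg (he.1 1) (hF0 E _ hasValue_zero)

variable [CompleteSpace H]

theorem isPosColumn_coeff (hF : IsHolomorphicOnBall.{v, u} A) (hRe : ReLeOneOnBall.{v, u} A)
    {k : ℕ} (hk : 1 ≤ k) :
    IsPosColumn (words n k) ((2 : ℝ) • (1 - A 1)) A ((2 : ℝ) • (1 - A 1)) := fun x y => by
  obtain ⟨E, _, _, _, S, e, he, hS, hSS⟩ := exists_fock_model.{v} n
  have hr : ∀ r ∈ Set.Ico (0 : ℝ) 1, 2 * ∑ α ∈ words n k, (inner ℂ (y α) ((r ^ k • A α) x)).re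
      ≤ (inner ℂ x (((2 : ℝ) • (1 - A 1)) x)).re
        + ∑ α ∈ words n k, (inner ℂ (y α) (((2 : ℝ) • (1 - A 1)) (y α))).re := fun r hr => by
    have hball := smul_mem_opBall hSS hr.1 hr.2
    obtain ⟨L, hL⟩ := hF E _ hball
    exact isPosColumn_of_realPart_le_one he hS hL (hRe E _ hball L hL) hk x y
  simp only [re_inner_smul_apply (_ ^ k), ← Finset.mul_sum] at hr
  have hlim : Filter.Tendsto
      (fun r : ℝ => 2 * (r ^ k * ∑ α ∈ words n k, (inner ℂ (y α) (A α x)).re)) (𝓝[<] 1)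
      (𝓝 (2 * (1 ^ k * ∑ α ∈ words n k, (inner ℂ (y α) (A α x)).re))) :=
    (Continuous.tendsto (by fun_prop) 1).mono_left nhdsWithin_le_nhds
  rw [one_pow, one_mul] at hlim
  refine le_of_tendsto hlim ?_
  filter_upwards [Ico_mem_nhdsLT one_pos] with r
  exact hr r

theorem coeff_one_le_one (hA : IsSelfAdjoint (A 1)) {k : ℕ}
    (h : IsPosColumn (words n k) ((2 : ℝ) • (1 - A 1)) A ((2 : ℝ) • (1 - A 1))) :
    A 1 ≤ 1 := by
  refine le_of_re_inner_le hA (IsSelfAdjoint.one _) fun x => ?_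
  have hx := h.re_inner_nonneg x
  rw [re_inner_smul_apply, sub_apply, inner_sub_right, Complex.sub_re] at hx
  linarith

end Coefficients

section Geometric

theorem hasSum_pow_succ {r : ℝ} (h0 : 0 ≤ r) (h1 : r < 1) :
    HasSum (fun k : ℕ => r ^ (k + 1)) (r / (1 - r)) := by
  simpa only [pow_succ', div_eq_mul_inv] using (hasSum_geometric_of_lt_one h0 h1).mul_left r

theorem summable_and_tsum_pow_smul_le {𝒜 : Type*} [CStarAlgebra 𝒜] [PartialOrder 𝒜]
    [StarOrderedRing 𝒜] {r : ℝ} (h0 : 0 ≤ r) (h1 : r < 1) {q : ℕ → 𝒜} {p : 𝒜}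
    (hq : ∀ k, 0 ≤ q k) (hqp : ∀ k, q k ≤ p) :
    Summable (fun k => r ^ (k + 1) • q k) ∧ ∑' k, r ^ (k + 1) • q k ≤ (r / (1 - r)) • p := by
  have hs : Summable fun k => r ^ (k + 1) • q k := by
    refine Summable.of_norm_bounded ((hasSum_pow_succ h0 h1).summable.mul_right ‖p‖) fun k => ?_
    rw [norm_smul, Real.norm_of_nonneg (by positivity)]
    gcongr
    exact CStarAlgebra.norm_le_norm_of_nonneg_of_le (hq k) (hqp k)
  have hp := (hasSum_pow_succ h0 h1).smul_const p
  exact ⟨hs, hp.tsum_eq ▸ hs.tsum_le_tsum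
    (fun k => smul_le_smul_of_nonneg_left (hqp k) (by positivity)) hp.summable⟩

end Geometric

section Contraction

variable {n : ℕ} {H E F : Type*} [NormedAddCommGroup H] [InnerProductSpace ℂ H]
  [NormedAddCommGroup E] [InnerProductSpace ℂ E] [NormedAddCommGroup F] [InnerProductSpace ℂ F]
  {A : FreeMonoid (Fin n) → BOp H}

theorem exists_hasValue_smul_of_isPosBlock {X : Fin n → BOp E} {P : BOp (HilbertTensor E H)}
    (h : ∀ k, IsPosBlock P (homPart A X (k + 1)) P) {r : ℝ} (h0 : 0 ≤ r) (h1 : r < 1) :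
    ∃ D, HasValue A (fun i => (r : ℂ) • X i) (opTensor 1 (A 1) + D) ∧
      IsPosBlock ((r / (1 - r)) • P) D ((r / (1 - r)) • P) := by
  have hpart : ∀ k, homPart A (fun i => (r : ℂ) • X i) k = r ^ k • homPart A X k := fun k => by
    rw [homPart_smul, ← Complex.ofReal_pow, Complex.coe_smul]
  have hgeom := hasSum_pow_succ h0 h1
  have hsum : Summable fun k => r ^ (k + 1) • homPart A X (k + 1) := by
    refine Summable.of_norm_bounded (hgeom.summable.mul_right ‖P‖) fun k => ?_
    rw [norm_smul, Real.norm_of_nonneg (by positivity)]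
    gcongr
    exact (h k).norm_le.trans_eq (Real.sqrt_mul_self (norm_nonneg P))
  refine ⟨_, ?_, IsPosBlock.hasSum (hgeom.smul_const P) hsum.hasSum (hgeom.smul_const P)
    fun k => (h k).smul (pow_nonneg h0 (k + 1))⟩
  have hvalue := (hasSum_nat_add_iff (f := fun k => r ^ k • homPart A X k) 1).1 hsum.hasSum
  rw [Finset.sum_range_one, pow_zero, one_smul, homPart_zero, add_comm] at hvalue
  simpa only [HasValue, hpart] using hvalue.tendsto_sum_nat

variable [CompleteSpace H] [CompleteSpace E]

theorem exists_hasValue_third_smul_norm_le_one {X : Fin n → BOp E} (h0 : 0 ≤ A 1)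
    (h : ∀ k, IsPosBlock (opTensor 1 ((2 : ℝ) • (1 - A 1))) (homPart A X (k + 1))
      (opTensor 1 ((2 : ℝ) • (1 - A 1)))) :
    ∃ L, HasValue A (fun i => ((1 / 3 : ℝ) : ℂ) • X i) L ∧ ‖L‖ ≤ 1 := by
  obtain ⟨D, hD, hblock⟩ :=
    exists_hasValue_smul_of_isPosBlock h (r := 1 / 3) (by norm_num) (by norm_num)
  have hgeom : (1 / 3 / (1 - 1 / 3) : ℝ) = 2⁻¹ := by norm_num
  rw [hgeom, opTensor_smul_right, inv_smul_smul₀ two_ne_zero] at hblock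
  have hone := (IsPosBlock.of_nonneg (opTensor_nonneg zero_le_one h0)).add hblock
  rw [← opTensor_add_right, add_sub_cancel, opTensor_one_one] at hone
  refine ⟨_, hD, hone.norm_le.trans ?_⟩
  rw [Real.sqrt_mul_self (norm_nonneg _)]
  exact ContinuousLinearMap.norm_id_le

variable [CompleteSpace F]

theorem isPosBlock_homPart {S : Fin n → BOp E} {Z : Fin n → BOp F}
    (hS : ∑ i, S i * star (S i) ≤ 1) (hZ : ∑ i, star (Z i) * Z i ≤ 1) {B : BOp H} (hB : 0 ≤ B)
    {k : ℕ} (h : ∀ α ∈ words n k, IsPosBlock B (A α) B) :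
    IsPosBlock (opTensor 1 B) (homPart A (fun i => opTensor (S i) (Z i)) k) (opTensor 1 B) := by
  have hfactor : ∀ α, opTensor (evalWord S α) (evalWord Z α)
      = opTensor (evalWord S α) 1 * opTensor 1 (evalWord Z α) := fun α => by
    rw [← opTensor_mul, one_mul, mul_one]
  simp only [homPart, evalWord_opTensor, hfactor]
  refine IsPosBlock.sum_opTensor ?_ ?_ hB h
  · simp only [star_opTensor, ← opTensor_mul, star_one, mul_one]
    rw [← opTensor_sum_left, ← opTensor_one_one]
    exact opTensor_le_opTensor_left (sum_evalWord_mul_star_le_one hS k) zero_le_one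
  · simp only [star_opTensor, ← opTensor_mul, star_one, mul_one]
    rw [← opTensor_sum_right, ← opTensor_one_one]
    exact opTensor_le_opTensor_right zero_le_one (sum_star_evalWord_mul_le_one hZ k)

theorem sum_star_smul_mul_smul_le_one {Y : Fin n → BOp F} {c : ℝ} (hc : 0 ≤ c)
    (hY : c * ‖rowOp fun i => star (Y i)‖ ≤ 1) :
    ∑ i, star (c • Y i) * (c • Y i) ≤ 1 := by
  have hrow := sum_mul_star_le_norm_rowOp fun i => star (Y i)
  simp only [star_star] at hrow
  calc ∑ i, star (c • Y i) * (c • Y i)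
      = c ^ 2 • ∑ i, star (Y i) * Y i := by
        simp only [star_smul, star_trivial, smul_mul_smul_comm, Finset.smul_sum, sq]
    _ ≤ c ^ 2 • ‖rowOp fun i => star (Y i)‖ ^ 2 • (1 : BOp F) :=
        smul_le_smul_of_nonneg_left hrow (sq_nonneg c)
    _ = (c * ‖rowOp fun i => star (Y i)‖) ^ 2 • (1 : BOp F) := by rw [smul_smul, mul_pow]
    _ ≤ (1 : ℝ) • (1 : BOp F) := smul_le_smul_of_nonneg_right
        (pow_le_one₀ (by positivity) hY) zero_le_one
    _ = 1 := one_smul ℝ _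

theorem exists_hasValue_and_norm_le_one {S : Fin n → BOp E} {Y : Fin n → BOp F}
    (hS : ∑ i, S i * star (S i) ≤ 1) (hY : ‖rowOp fun i => star (Y i)‖ ≤ 1 / 3) (h0 : 0 ≤ A 1)
    (h1 : A 1 ≤ 1)
    (h : ∀ k, 1 ≤ k → IsPosColumn (words n k) ((2 : ℝ) • (1 - A 1)) A ((2 : ℝ) • (1 - A 1))) :
    ∃ L, HasValue A (fun i => opTensor (S i) (Y i)) L ∧ ‖L‖ ≤ 1 := by
  let Z : Fin n → BOp F := fun i => (3 : ℝ) • Y i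
  have hYZ : (fun i => opTensor (S i) (Y i))
      = fun i => ((1 / 3 : ℝ) : ℂ) • opTensor (S i) (Z i) := by
    funext i
    rw [opTensor_smul_right, Complex.coe_smul, smul_smul]
    norm_num
  have hZ : ∑ i, star (Z i) * Z i ≤ 1 :=
    sum_star_smul_mul_smul_le_one zero_le_three (by linarith)
  have hB : 0 ≤ (2 : ℝ) • (1 - A 1) := smul_nonneg zero_le_two (sub_nonneg.2 h1)
  rw [hYZ]
  exact exists_hasValue_third_smul_norm_le_one h0 fun k =>
    isPosBlock_homPart hS hZ hB fun _ => (h (k + 1) k.succ_pos).isPosBlock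

end Contraction

section Majorants

variable {𝒜 : Type*} [CStarAlgebra 𝒜] [PartialOrder 𝒜] [StarOrderedRing 𝒜]

theorem one_sub_mul_self_add_smul_le {R : 𝒜} (hR : IsSelfAdjoint R) (c : ℝ) :
    1 - R * R + (2 * c) • R ≤ (1 + c ^ 2) • (1 : 𝒜) := by
  rw [← sub_nonneg]
  refine (((IsSelfAdjoint.all c).smul (IsSelfAdjoint.one 𝒜)).sub hR).mul_self_nonneg.trans_eq ?_
  simp only [sub_mul, mul_sub, smul_mul_assoc, mul_smul_comm, one_mul, mul_one]
  module

theorem one_sub_mul_self_add_smul_le_of_le_one {R : 𝒜} (hR : R ≤ 1) {c : ℝ} (hc : 1 ≤ c) :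
    1 - R * R + (2 * c) • R ≤ (2 * c) • (1 : 𝒜) := by
  have hR' : 0 ≤ 1 - R := sub_nonneg.2 hR
  have hsq := (IsSelfAdjoint.of_nonneg hR').mul_self_nonneg
  have hlin := smul_nonneg (by linarith : 0 ≤ 2 * c - 2) hR'
  rw [← sub_nonneg]
  refine (add_nonneg hsq hlin).trans_eq ?_
  simp only [sub_mul, mul_sub, one_mul, mul_one]
  module

theorem add_smul_sqrt_one_sub_le_M {a : 𝒜} (h0 : 0 ≤ a) (h1 : a ≤ 1) {r : ℝ} (hr : r < 1) :
    a + (r / (1 - r)) • (2 : ℝ) • CFC.sqrt (1 - a) ≤ M r • (1 : 𝒜) := by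
  set R := CFC.sqrt (1 - a)
  have ha : a = 1 - R * R := by
    rw [CFC.sqrt_mul_sqrt_self _ (sub_nonneg.2 h1), sub_sub_cancel]
  have hR1 : R ≤ 1 := by
    simpa only [CFC.sqrt_one] using CFC.sqrt_le_sqrt _ _ (sub_le_self 1 h0)
  rw [ha, smul_smul, mul_comm (r / (1 - r)), M]
  split_ifs with hr'
  · rw [← div_pow]
    exact one_sub_mul_self_add_smul_le (IsSelfAdjoint.of_nonneg (CFC.sqrt_nonneg _)) _
  · rw [mul_div_assoc]
    refine one_sub_mul_self_add_smul_le_of_le_one hR1 ?_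
    rw [le_div_iff₀ (sub_pos.2 hr)]
    linarith

theorem add_smul_one_sub_le {a : 𝒜} (h0 : 0 ≤ a) (h1 : a ≤ 1) (c : ℝ) :
    a + c • (1 - a) ≤ max 1 c • (1 : 𝒜) := by
  have ha := smul_nonneg (sub_nonneg.2 (le_max_left 1 c)) h0
  have hb := smul_nonneg (sub_nonneg.2 (le_max_right 1 c)) (sub_nonneg.2 h1)
  rw [← sub_nonneg]
  refine (add_nonneg ha hb).trans_eq ?_
  module

theorem K_eq_max {r : ℝ} (hr : r < 1) : K r = max 1 (4 * (r / (1 - r))) := by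
  have h1r : 0 < 1 - r := sub_pos.2 hr
  rw [K, mul_div_assoc]
  split_ifs with h
  · refine (max_eq_left ?_).symm
    rw [← mul_div_assoc, div_le_one h1r]
    linarith
  · refine (max_eq_right ?_).symm
    rw [← mul_div_assoc, le_div_iff₀ h1r]
    linarith

end Majorants

section CoeffSq

variable {n : ℕ} {H : Type*} [NormedAddCommGroup H] [InnerProductSpace ℂ H] [CompleteSpace H]
  {A : FreeMonoid (Fin n) → BOp H}

theorem coeffSq_nonneg (k : ℕ) : 0 ≤ coeffSq A k :=
  Finset.sum_nonneg fun _ _ => star_mul_self_nonneg _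

theorem coeffSq_zero : coeffSq A 0 = star (A 1) * A 1 := by
  rw [coeffSq, words_zero, Finset.sum_singleton]

theorem sqrt_norm_coeffSq_zero : √‖coeffSq A 0‖ = ‖A 1‖ := by
  rw [coeffSq_zero, CStarRing.norm_star_mul_self, Real.sqrt_mul_self (norm_nonneg _)]

theorem sqrt_coeffSq_zero (h0 : 0 ≤ A 1) : CFC.sqrt (coeffSq A 0) = A 1 := by
  rw [coeffSq_zero, (IsSelfAdjoint.of_nonneg h0).star_eq, CFC.sqrt_mul_self _ h0]

theorem coeffSq_le_norm_smul (h1 : A 1 ≤ 1) {k : ℕ}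
    (h : IsPosColumn (words n k) ((2 : ℝ) • (1 - A 1)) A ((2 : ℝ) • (1 - A 1))) :
    coeffSq A k ≤ ‖(2 : ℝ) • (1 - A 1)‖ • (2 : ℝ) • (1 - A 1) := by
  have hB := IsSelfAdjoint.of_nonneg (smul_nonneg (zero_le_two (α := ℝ)) (sub_nonneg.2 h1))
  have hsum := h.sum_star_mul_mul_le hB zero_le_one (norm_nonneg _) (by
    simpa only [one_mul, mul_one, Algebra.algebraMap_eq_smul_one] using hB.le_algebraMap_norm_self)
  simpa only [coeffSq, mul_one] using hsum

theorem coeffSq_le (h0 : 0 ≤ A 1) (h1 : A 1 ≤ 1) {k : ℕ}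
    (h : IsPosColumn (words n k) ((2 : ℝ) • (1 - A 1)) A ((2 : ℝ) • (1 - A 1))) :
    coeffSq A k ≤ (4 : ℝ) • (1 - A 1) := by
  have hB : 0 ≤ 1 - A 1 := sub_nonneg.2 h1
  have hnorm : ‖1 - A 1‖ ≤ 1 :=
    (CStarAlgebra.norm_le_one_iff_of_nonneg _ hB).2 (sub_le_self 1 h0)
  refine (coeffSq_le_norm_smul h1 h).trans ?_
  rw [norm_smul, Real.norm_two, smul_smul]
  exact smul_le_smul_of_nonneg_right (by linarith) hB

theorem sqrt_norm_coeffSq_le (h1 : A 1 ≤ 1) {k : ℕ}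
    (h : IsPosColumn (words n k) ((2 : ℝ) • (1 - A 1)) A ((2 : ℝ) • (1 - A 1))) :
    √‖coeffSq A k‖ ≤ 2 * ‖1 - A 1‖ := by
  rw [Real.sqrt_le_left (by positivity)]
  calc ‖coeffSq A k‖ ≤ ‖‖(2 : ℝ) • (1 - A 1)‖ • (2 : ℝ) • (1 - A 1)‖ :=
        CStarAlgebra.norm_le_norm_of_nonneg_of_le (coeffSq_nonneg k) (coeffSq_le_norm_smul h1 h)
    _ = (2 * ‖1 - A 1‖) ^ 2 := by rw [norm_smul, norm_norm, norm_smul, Real.norm_two, sq]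

theorem sqrt_coeffSq_le (h0 : 0 ≤ A 1) (h1 : A 1 ≤ 1) {k : ℕ}
    (h : IsPosColumn (words n k) ((2 : ℝ) • (1 - A 1)) A ((2 : ℝ) • (1 - A 1))) :
    CFC.sqrt (coeffSq A k) ≤ (2 : ℝ) • CFC.sqrt (1 - A 1) := by
  refine (CFC.sqrt_le_sqrt _ _ (coeffSq_le h0 h1 h)).trans_eq ?_
  refine CFC.sqrt_unique ?_ (smul_nonneg zero_le_two (CFC.sqrt_nonneg (1 - A 1)))
  rw [smul_mul_smul_comm, CFC.sqrt_mul_sqrt_self _ (sub_nonneg.2 h1)]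
  norm_num

theorem sum_star_mul_inverse_mul_le (h1 : A 1 ≤ 1) (hu : IsUnit (1 - A 1)) {k : ℕ}
    (h : IsPosColumn (words n k) ((2 : ℝ) • (1 - A 1)) A ((2 : ℝ) • (1 - A 1))) :
    ∑ α ∈ words n k, star (A α) * Ring.inverse (1 - A 1) * A α ≤ (4 : ℝ) • (1 - A 1) := by
  have hB : 0 ≤ 1 - A 1 := sub_nonneg.2 h1
  have hinv : 0 ≤ Ring.inverse (1 - A 1) :=
    (CFC.ringInverse_nonneg_iff_nonneg_of_isUnit hu).2 hB
  refine (h.sum_star_mul_mul_le (IsSelfAdjoint.of_nonneg (smul_nonneg zero_le_two hB)) hinv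
    (zero_le_two (α := ℝ)) ?_).trans_eq ?_
  · rw [mul_smul_comm, smul_mul_assoc, Ring.inverse_mul_cancel _ hu, one_mul]
  · rw [smul_smul]
    norm_num

theorem summable_and_tsum_sqrt_coeffSq_le (h0 : 0 ≤ A 1) (h1 : A 1 ≤ 1)
    (h : ∀ k, 1 ≤ k → IsPosColumn (words n k) ((2 : ℝ) • (1 - A 1)) A ((2 : ℝ) • (1 - A 1)))
    {r : ℝ} (hr0 : 0 ≤ r) (hr1 : r < 1) :
    Summable (fun k : ℕ => r ^ k • CFC.sqrt (coeffSq A k)) ∧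
      ∑' k : ℕ, r ^ k • CFC.sqrt (coeffSq A k) ≤ M r • (1 : BOp H) := by
  obtain ⟨hsum, hle⟩ := summable_and_tsum_pow_smul_le hr0 hr1
    (fun k => CFC.sqrt_nonneg (coeffSq A (k + 1)))
    fun k => sqrt_coeffSq_le h0 h1 (h (k + 1) k.succ_pos)
  have hsum' := (summable_nat_add_iff (f := fun k => r ^ k • CFC.sqrt (coeffSq A k)) 1).1 hsum
  refine ⟨hsum', ?_⟩
  rw [hsum'.tsum_eq_zero_add, pow_zero, one_smul, sqrt_coeffSq_zero h0]
  exact (add_le_add_right hle _).trans (add_smul_sqrt_one_sub_le_M h0 h1 hr1)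

theorem summable_and_tsum_inverse_le (h0 : 0 ≤ A 1) (h1 : A 1 ≤ 1)
    (h : ∀ k, 1 ≤ k → IsPosColumn (words n k) ((2 : ℝ) • (1 - A 1)) A ((2 : ℝ) • (1 - A 1)))
    (hu : IsUnit (1 - A 1)) {r : ℝ} (hr0 : 0 ≤ r) (hr1 : r < 1) :
    Summable (fun k : ℕ => ∑ α ∈ words n (k + 1),
        r ^ (k + 1) • (star (A α) * Ring.inverse (1 - A 1) * A α)) ∧
      A 1 + ∑' k : ℕ, ∑ α ∈ words n (k + 1),
        r ^ (k + 1) • (star (A α) * Ring.inverse (1 - A 1) * A α) ≤ K r • (1 : BOp H) := by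
  have hinv : 0 ≤ Ring.inverse (1 - A 1) :=
    (CFC.ringInverse_nonneg_iff_nonneg_of_isUnit hu).2 (sub_nonneg.2 h1)
  obtain ⟨hsum, hle⟩ := summable_and_tsum_pow_smul_le hr0 hr1
    (q := fun k => ∑ α ∈ words n (k + 1), star (A α) * Ring.inverse (1 - A 1) * A α)
    (fun k => Finset.sum_nonneg fun α _ => star_left_conjugate_nonneg hinv _)
    fun k => sum_star_mul_inverse_mul_le h1 hu (h (k + 1) k.succ_pos)
  simp only [← Finset.smul_sum]
  refine ⟨hsum, (add_le_add_right hle _).trans ?_⟩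
  rw [smul_smul, mul_comm, K_eq_max hr1]
  exact add_smul_one_sub_le h0 h1 _

theorem summable_and_tsum_sqrt_norm_coeffSq_le (h1 : A 1 ≤ 1)
    (h : ∀ k, 1 ≤ k → IsPosColumn (words n k) ((2 : ℝ) • (1 - A 1)) A ((2 : ℝ) • (1 - A 1)))
    {r : ℝ} (hr0 : 0 ≤ r) (hr1 : r ≤ 1 / 3) :
    Summable (fun k : ℕ => r ^ k * √‖coeffSq A k‖) ∧
      ∑' k : ℕ, r ^ k * √‖coeffSq A k‖ ≤ ‖A 1‖ + ‖1 - A 1‖ := by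
  have hgeom := (hasSum_pow_succ hr0 (by linarith)).mul_right (2 * ‖1 - A 1‖)
  have hle : ∀ k : ℕ, r ^ (k + 1) * √‖coeffSq A (k + 1)‖ ≤ r ^ (k + 1) * (2 * ‖1 - A 1‖) :=
    fun k => mul_le_mul_of_nonneg_left (sqrt_norm_coeffSq_le h1 (h (k + 1) k.succ_pos))
      (by positivity)
  have hsum := Summable.of_nonneg_of_le (fun k => by positivity) hle hgeom.summable
  have hsum' := (summable_nat_add_iff (f := fun k => r ^ k * √‖coeffSq A k‖) 1).1 hsum
  have hhalf : r / (1 - r) ≤ 1 / 2 := by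
    rw [div_le_iff₀ (by linarith)]
    linarith
  refine ⟨hsum', ?_⟩
  rw [hsum'.tsum_eq_zero_add, pow_zero, one_mul, sqrt_norm_coeffSq_zero]
  gcongr
  calc ∑' k : ℕ, r ^ (k + 1) * √‖coeffSq A (k + 1)‖
      ≤ r / (1 - r) * (2 * ‖1 - A 1‖) := hgeom.tsum_eq ▸ hsum.tsum_le_tsum hle hgeom.summable
    _ ≤ 1 / 2 * (2 * ‖1 - A 1‖) := by gcongr
    _ = ‖1 - A 1‖ := by ring

end CoeffSq

end
end NCBohr

theorem theorem2p5 {n : ℕ} (hn : 1 ≤ n)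
    {H : Type u} [NormedAddCommGroup H] [InnerProductSpace ℂ H] [CompleteSpace H]
    (A : FreeMonoid (Fin n) → (H →L[ℂ] H))
    (hF : NCBohr.IsHolomorphicOnBall.{v, u} A)
    (hF0 : NCBohr.NonnegAtZero.{v, u} A)
    (hRe : NCBohr.ReLeOneOnBall.{v, u} A) :
    (∀ (𝒦 : Type w) [NormedAddCommGroup 𝒦] [InnerProductSpace ℂ 𝒦] [CompleteSpace 𝒦]
      (Y : Fin n → (𝒦 →L[ℂ] 𝒦)), ‖NCBohr.rowOp (fun i => star (Y i))‖ ≤ 1 / 3 →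
        ∃ L, NCBohr.HasValue A (fun i => NCBohr.opTensor (NCBohr.creation i) (Y i)) L ∧
          ‖L‖ ≤ 1) ∧
    (∀ k : ℕ, 1 ≤ k → NCBohr.coeffSq A k ≤ (4 : ℝ) • (1 - A 1)) ∧
    (∀ k : ℕ, 1 ≤ k → √‖NCBohr.coeffSq A k‖ ≤ 2 * ‖1 - A 1‖) ∧
    (∀ r : ℝ, 0 ≤ r → r < 1 →
      Summable (fun k : ℕ => r ^ k • CFC.sqrt (NCBohr.coeffSq A k)) ∧
      ∑' k : ℕ, r ^ k • CFC.sqrt (NCBohr.coeffSq A k) ≤ NCBohr.M r • (1 : H →L[ℂ] H)) ∧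
    (‖A 1‖ < 1 → IsUnit (1 - A 1) ∧ ∀ r : ℝ, 0 ≤ r → r < 1 →
      Summable (fun k : ℕ => ∑ α ∈ NCBohr.words n (k + 1),
        r ^ (k + 1) • (star (A α) * Ring.inverse (1 - A 1) * A α)) ∧
      A 1 + ∑' k : ℕ, ∑ α ∈ NCBohr.words n (k + 1),
        r ^ (k + 1) • (star (A α) * Ring.inverse (1 - A 1) * A α)
          ≤ NCBohr.K r • (1 : H →L[ℂ] H)) ∧
    (∀ r : ℝ, 0 ≤ r → r ≤ 1 / 3 →
      Summable (fun k : ℕ => r ^ k * √‖NCBohr.coeffSq A k‖) ∧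
      ∑' k : ℕ, r ^ k * √‖NCBohr.coeffSq A k‖ ≤ ‖A 1‖ + ‖1 - A 1‖) := by
  have h0 := NCBohr.coeff_one_nonneg hF0
  have h := fun k (hk : 1 ≤ k) => NCBohr.isPosColumn_coeff hF hRe hk
  have h1 := NCBohr.coeff_one_le_one (.of_nonneg h0) (h 1 le_rfl)
  exact ⟨fun 𝒦 _ _ _ Y hY => NCBohr.exists_hasValue_and_norm_le_one
      (NCBohr.sum_mul_star_le_one_of_inner NCBohr.inner_creation) hY h0 h1 h,
    fun k hk => NCBohr.coeffSq_le h0 h1 (h k hk),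
    fun k hk => NCBohr.sqrt_norm_coeffSq_le h1 (h k hk),
    fun r hr0 hr1 => NCBohr.summable_and_tsum_sqrt_coeffSq_le h0 h1 h hr0 hr1,
    fun hA => ⟨isUnit_one_sub_of_norm_lt_one hA, fun r hr0 hr1 =>
      NCBohr.summable_and_tsum_inverse_le h0 h1 h (isUnit_one_sub_of_norm_lt_one hA) hr0 hr1⟩,
    fun r hr0 hr1 => NCBohr.summable_and_tsum_sqrt_norm_coeffSq_le h1 h hr0 hr1⟩
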